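/- Work in equational logic over the signature $\{0,1,-,+,\cdot,/\}$ of divisive meadows ($-$ unary), with a countably infinite supply of variables. Let $E_{\mathrm{Md}}$ be the following set of axioms: $(x+y)+z=x+(y+z)$, $x+y=y+x$, $x+0=x$, $x+(-x)=0$, $(x\cdot y)\cdot z=x\cdot(y\cdot z)$, $x\cdot y=y\cdot x$, $1\cdot x=x$, $x\cdot(y+z)=x\cdot y+x\cdot z$, $1/(1/x)=x$, $(x\cdot x)/x=x$, $x/y=x\cdot(1/y)$. A simple fraction is a term $p/q$ in which $p$ and $q$ are terms without the division symbol. A polynomial is an expression built from variables and closed (variable-free) simple fractions by addition, multiplication and exponentiation with natural-number exponents (an abbreviation of iterated products). For a natural number $n$, write $\underline{n}$ for the numeral $0+1+\cdots+1$ ($n$ ones). Theorem. Let $t$ be a term over this signature in which at most one variable $x$ occurs. Then there are a polynomial $g$ and a simple fraction $f$, in each of which no variable other than $x$ occurs, and a natural number $n>0$ such that $$E_{\mathrm{Md}}\cup\{\underline{n}/\underline{n}=1\}\vdash t=g+f$$ and $$E_{\mathrm{Md}}\vdash \underline{n}\cdot t=\underline{n}\cdot(g+f).$$ Moreover, for all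 such polynomials $g$, simple fractions $f$ and natural numbers $n>0$ these two provability claims are equivalent. -/

import Mathlib

namespace DivisiveMeadow

/-- Terms over the signature `{0, 1, -, +, ⬝, /}` of divisive meadows, with variables indexed by
the natural numbers. The symbol `-` is the unary one. -/
inductive Term : Type
  | var : ℕ → Term
  | zero : Term
  | one : Term
  | neg : Term → Term
  | add : Term → Term → Term
  | mul : Term → Term → Term
  | div : Term → Term → Term

namespace Term

/-- The set of variables that occur in a term. -/
def vars : Term → Set ℕ
  | var i => {i}
  | zero => ∅
  | one => ∅
  | neg s => s.vars
  | add s t => s.vars ∪ t.vars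
  | mul s t => s.vars ∪ t.vars
  | div s t => s.vars ∪ t.vars

/-- Simultaneous substitution of terms for variables. -/
def subst (σ : ℕ → Term) : Term → Term
  | var i => σ i
  | zero => zero
  | one => one
  | neg s => neg (s.subst σ)
  | add s t => add (s.subst σ) (t.subst σ)
  | mul s t => mul (s.subst σ) (t.subst σ)
  | div s t => div (s.subst σ) (t.subst σ)

/-- The term has no occurrence of the division symbol. -/
def DivFree : Term → Prop
  | var _ => True
  | zero => True
  | one => True
  | neg s => s.DivFree
  | add s t => s.DivFree ∧ t.DivFree
  | mul s t => s.DivFree ∧ t.DivFree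
  | div _ _ => False

/-- A simple fraction is a term `p / q` where `p` and `q` are terms without division symbol. -/
def IsSimpleFraction (f : Term) : Prop :=
  ∃ p q : Term, p.DivFree ∧ q.DivFree ∧ f = div p q

/-- The numeral of a natural number, `0 + 1 + ⋯ + 1`. -/
def numeral : ℕ → Term
  | 0 => zero
  | n + 1 => add (numeral n) one

/-- Exponentiation with a natural number as exponent, which abbreviates an iterated product. -/
def pow (t : Term) : ℕ → Term
  | 0 => one
  | k + 1 => mul (pow t k) t

/-- Polynomials: the expressions built from variables and closed simple fractions by addition,
multiplication and exponentiation. -/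
inductive IsPolynomial : Term → Prop
  | var (i : ℕ) : IsPolynomial (var i)
  | const (c : Term) : c.IsSimpleFraction → c.vars = ∅ → IsPolynomial c
  | add (s t : Term) : IsPolynomial s → IsPolynomial t → IsPolynomial (add s t)
  | mul (s t : Term) : IsPolynomial s → IsPolynomial t → IsPolynomial (mul s t)
  | pow (s : Term) (k : ℕ) : IsPolynomial s → IsPolynomial (pow s k)

end Term

/-- An equation between two terms; the pair `(s, t)` stands for `s = t`. -/
abbrev Equation : Type := Term × Term

open Term in
/-- The axioms of divisive meadows, with `x`, `y`, `z` the variables `0`, `1`, `2`. -/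
inductive EMd : Equation → Prop
  | add_assoc : EMd
      (add (add (var 0) (var 1)) (var 2), add (var 0) (add (var 1) (var 2)))
  | add_comm : EMd (add (var 0) (var 1), add (var 1) (var 0))
  | add_zero : EMd (add (var 0) zero, var 0)
  | add_neg : EMd (add (var 0) (neg (var 0)), zero)
  | mul_assoc : EMd
      (mul (mul (var 0) (var 1)) (var 2), mul (var 0) (mul (var 1) (var 2)))
  | mul_comm : EMd (mul (var 0) (var 1), mul (var 1) (var 0))
  | one_mul : EMd (mul one (var 0), var 0)
  | mul_add : EMd
      (mul (var 0) (add (var 1) (var 2)), add (mul (var 0) (var 1)) (mul (var 0) (var 2)))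
  | div_div : EMd (div one (div one (var 0)), var 0)
  | sq_div : EMd (div (mul (var 0) (var 0)) (var 0), var 0)
  | div_eq : EMd (div (var 0) (var 1), mul (var 0) (div one (var 1)))

/-- The set of axioms of divisive meadows. -/
def axiomsMd : Set Equation := {e | EMd e}

/-- `Provable E s t` says that `s = t` is derivable in equational logic from the set `E` of
equations: provable equality is the least congruence on terms that contains all substitution
instances of the equations in `E`. -/
inductive Provable (E : Set Equation) : Term → Term → Prop
  | ax (s t : Term) (σ : ℕ → Term) : (s, t) ∈ E → Provable E (s.subst σ) (t.subst σ)
  | refl (s : Term) : Provable E s s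
  | symm (s t : Term) : Provable E s t → Provable E t s
  | trans (s t u : Term) : Provable E s t → Provable E t u → Provable E s u
  | neg (s t : Term) : Provable E s t → Provable E (Term.neg s) (Term.neg t)
  | add (s t s' t' : Term) : Provable E s t → Provable E s' t' →
      Provable E (Term.add s s') (Term.add t t')
  | mul (s t s' t' : Term) : Provable E s t → Provable E s' t' →
      Provable E (Term.mul s s') (Term.mul t t')
  | div (s t s' t' : Term) : Provable E s t → Provable E s' t' →
      Provable E (Term.div s s') (Term.div t t')

/-- The equation `n / n = 1`. -/
def numeralDivSelf (n : ℕ) : Equation :=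
  (Term.div (Term.numeral n) (Term.numeral n), Term.one)

end DivisiveMeadow

/-!
Provable equality from a set `E` of equations containing the axioms of divisive meadows is
characterised semantically. Terms modulo provable equality form a commutative von Neumann regular
ring; such a ring is reduced, so two different elements stay different modulo some prime ideal, and
the quotient by a prime ideal is a field whose inverse is the one of the meadow, with `0⁻¹ = 0`.
Hence `E` proves `s = t` iff `s = t` holds in every field satisfying `E` (`provable_iff`).

In particular, the axioms together with `n / n = 1` describe the fields in which `n ≠ 0`. As
`n ⬝ s = n ⬝ t` holds trivially in the other fields, this already gives the equivalence of the two
provability claims (`provable_numeralDivSelf_iff_provable_mul`).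

For existence, by the finiteness of derivations (`exists_provable_of_provable_numeralDivSelf`) it is
enough to find `g` and `f` such that `t = g + f` holds in all fields of characteristic zero. There
`t` is generically a rational function: `t(a) = p(a) / q(a)` wherever `q(a) ≠ 0`, for some
`p, q ∈ ℤ[X]` with `q ≠ 0`. On the zero set of `q` it agrees with a polynomial `G ∈ ℚ[X]`, because
`ℚ[X]` modulo the radical of `q` is von Neumann regular, so that polynomial functions on this zero
set are closed under inversion. Since division by zero yields zero, `t = G + (p - G q) / q` holds
everywhere.
-/

namespace DivisiveMeadow

open Polynomial

/-! ### Evaluation of terms in fields -/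

namespace Term

/-- The value of a term in a field under a valuation of the variables. Division is that of
Mathlib, so `a / 0 = 0`, which makes every field a divisive meadow. -/
def eval {K : Type*} [Field K] (v : ℕ → K) : Term → K
  | var i => v i
  | zero => 0
  | one => 1
  | neg s => -s.eval v
  | add s t => s.eval v + t.eval v
  | mul s t => s.eval v * t.eval v
  | div s t => s.eval v / t.eval v

theorem eval_subst {K : Type*} [Field K] (v : ℕ → K) (σ : ℕ → Term) (t : Term) :
    (t.subst σ).eval v = t.eval fun i => (σ i).eval v := by
  induction t <;> simp_all [subst, eval]

@[simp]
theorem eval_numeral {K : Type*} [Field K] (v : ℕ → K) (n : ℕ) :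
    (numeral n).eval v = n := by
  induction n <;> simp_all [numeral, eval]

@[simp]
theorem vars_numeral (n : ℕ) : (numeral n).vars = ∅ := by
  induction n <;> simp_all [numeral, vars]

theorem divFree_numeral (n : ℕ) : (numeral n).DivFree := by
  induction n <;> simp_all [numeral, DivFree]

end Term

/-- A field satisfies a set of equations if each of them holds under all valuations. -/
def Satisfies (K : Type*) [Field K] (E : Set Equation) : Prop :=
  ∀ e ∈ E, ∀ v : ℕ → K, e.1.eval v = e.2.eval v

theorem satisfies_axiomsMd (K : Type*) [Field K] : Satisfies K axiomsMd := by
  rintro _ h v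
  cases h <;> simp only [Term.eval]
  · ring
  · ring
  · ring
  · ring
  · ring
  · ring
  · ring
  · ring
  · simp
  · simp
  · simp [div_eq_mul_inv]

theorem Provable.eval_eq {E : Set Equation} {s t : Term} (h : Provable E s t) {K : Type*} [Field K]
    (hK : Satisfies K E) (v : ℕ → K) : s.eval v = t.eval v := by
  induction h with
  | ax s t σ h => simpa only [Term.eval_subst] using hK _ h _
  | refl => rfl
  | symm _ _ _ ih => exact ih.symm
  | trans _ _ _ _ _ ih₁ ih₂ => exact ih₁.trans ih₂
  | neg _ _ _ ih => simp [Term.eval, ih]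
  | add _ _ _ _ _ _ ih₁ ih₂ => simp [Term.eval, ih₁, ih₂]
  | mul _ _ _ _ _ _ ih₁ ih₂ => simp [Term.eval, ih₁, ih₂]
  | div _ _ _ _ _ _ ih₁ ih₂ => simp [Term.eval, ih₁, ih₂]

/-! ### The algebra of terms modulo provable equality -/

/-- Provable equality as an equivalence relation on terms. -/
def provableSetoid (E : Set Equation) : Setoid Term where
  r := Provable E
  iseqv := ⟨.refl, fun h => .symm _ _ h, fun h₁ h₂ => .trans _ _ _ h₁ h₂⟩

/-- The Lindenbaum algebra of `E`: the terms modulo provable equality from `E`. -/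
def TermAlgebra (E : Set Equation) : Type :=
  Quotient (provableSetoid E)

namespace TermAlgebra

variable {E : Set Equation}

/-- The class of a term in the Lindenbaum algebra. -/
def mk (E : Set Equation) (t : Term) : TermAlgebra E :=
  Quotient.mk (provableSetoid E) t

theorem mk_eq_mk {s t : Term} : mk E s = mk E t ↔ Provable E s t :=
  Quotient.eq (r := provableSetoid E)

theorem mk_surjective : Function.Surjective (mk E) :=
  Quotient.mk_surjective

instance : Zero (TermAlgebra E) := ⟨mk E .zero⟩
instance : One (TermAlgebra E) := ⟨mk E .one⟩
instance : Neg (TermAlgebra E) :=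
  ⟨Quotient.map (sa := provableSetoid E) (sb := provableSetoid E) .neg fun _ _ h => .neg _ _ h⟩
instance : Add (TermAlgebra E) :=
  ⟨Quotient.map₂ (sa := provableSetoid E) (sb := provableSetoid E) (sc := provableSetoid E) .add
    fun _ _ h₁ _ _ h₂ => .add _ _ _ _ h₁ h₂⟩
instance : Mul (TermAlgebra E) :=
  ⟨Quotient.map₂ (sa := provableSetoid E) (sb := provableSetoid E) (sc := provableSetoid E) .mul
    fun _ _ h₁ _ _ h₂ => .mul _ _ _ _ h₁ h₂⟩
instance : Div (TermAlgebra E) :=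
  ⟨Quotient.map₂ (sa := provableSetoid E) (sb := provableSetoid E) (sc := provableSetoid E) .div
    fun _ _ h₁ _ _ h₂ => .div _ _ _ _ h₁ h₂⟩

theorem mk_neg (s : Term) : mk E (.neg s) = -mk E s := rfl
theorem mk_add (s t : Term) : mk E (.add s t) = mk E s + mk E t := rfl
theorem mk_mul (s t : Term) : mk E (.mul s t) = mk E s * mk E t := rfl
theorem mk_div (s t : Term) : mk E (.div s t) = mk E s / mk E t := rfl

/-- The substitution that replaces the variables `0`, `1`, `2`, in terms of which the axioms of
divisive meadows are written, by the given terms. -/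
def substThree (a b c : Term) : ℕ → Term
  | 0 => a
  | 1 => b
  | _ => c

theorem mk_subst_eq_of_axiom (hE : axiomsMd ⊆ E) {e : Equation} (h : EMd e) (a b c : Term) :
    mk E (e.1.subst (substThree a b c)) = mk E (e.2.subst (substThree a b c)) :=
  mk_eq_mk.2 (.ax _ _ _ (hE h))

/-- The ring structure on the Lindenbaum algebra of an extension of the axioms of divisive
meadows. -/
@[reducible]
def commRing (hE : axiomsMd ⊆ E) : CommRing (TermAlgebra E) :=
  have add_comm (a b : TermAlgebra E) : a + b = b + a := by
    obtain ⟨a, rfl⟩ := mk_surjective a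
    obtain ⟨b, rfl⟩ := mk_surjective b
    exact mk_subst_eq_of_axiom hE .add_comm a b b
  have mul_comm (a b : TermAlgebra E) : a * b = b * a := by
    obtain ⟨a, rfl⟩ := mk_surjective a
    obtain ⟨b, rfl⟩ := mk_surjective b
    exact mk_subst_eq_of_axiom hE .mul_comm a b b
  have add_zero (a : TermAlgebra E) : a + 0 = a := by
    obtain ⟨a, rfl⟩ := mk_surjective a
    exact mk_subst_eq_of_axiom hE .add_zero a a a
  have add_neg (a : TermAlgebra E) : a + -a = 0 := by
    obtain ⟨a, rfl⟩ := mk_surjective a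
    exact mk_subst_eq_of_axiom hE .add_neg a a a
  have one_mul (a : TermAlgebra E) : 1 * a = a := by
    obtain ⟨a, rfl⟩ := mk_surjective a
    exact mk_subst_eq_of_axiom hE .one_mul a a a
  have add_assoc (a b c : TermAlgebra E) : a + b + c = a + (b + c) := by
    obtain ⟨a, rfl⟩ := mk_surjective a
    obtain ⟨b, rfl⟩ := mk_surjective b
    obtain ⟨c, rfl⟩ := mk_surjective c
    exact mk_subst_eq_of_axiom hE .add_assoc a b c
  have mul_assoc (a b c : TermAlgebra E) : a * b * c = a * (b * c) := by
    obtain ⟨a, rfl⟩ := mk_surjective a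
    obtain ⟨b, rfl⟩ := mk_surjective b
    obtain ⟨c, rfl⟩ := mk_surjective c
    exact mk_subst_eq_of_axiom hE .mul_assoc a b c
  have mul_add (a b c : TermAlgebra E) : a * (b + c) = a * b + a * c := by
    obtain ⟨a, rfl⟩ := mk_surjective a
    obtain ⟨b, rfl⟩ := mk_surjective b
    obtain ⟨c, rfl⟩ := mk_surjective c
    exact mk_subst_eq_of_axiom hE .mul_add a b c
  have zero_mul (a : TermAlgebra E) : 0 * a = 0 := by
    have h : a * 0 + a * 0 = a * 0 := by rw [← mul_add, add_zero]
    have h' := congrArg (· + -(a * 0)) h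
    simpa only [add_assoc, add_neg, add_zero, mul_comm a 0] using h'
  { add_assoc := add_assoc
    zero_add := fun a => by rw [add_comm, add_zero]
    add_zero := add_zero
    nsmul := nsmulRec
    add_comm := add_comm
    left_distrib := mul_add
    right_distrib := fun a b c => by rw [mul_comm, mul_add, mul_comm c a, mul_comm c b]
    zero_mul := zero_mul
    mul_zero := fun a => by rw [mul_comm, zero_mul]
    mul_assoc := mul_assoc
    one_mul := one_mul
    mul_one := fun a => by rw [mul_comm, one_mul]
    zsmul := zsmulRec
    neg_add_cancel := fun a => by rw [add_comm, add_neg]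
    mul_comm := mul_comm }

theorem one_div_one_div (hE : axiomsMd ⊆ E) (a : TermAlgebra E) : 1 / (1 / a) = a := by
  obtain ⟨a, rfl⟩ := mk_surjective a
  exact mk_subst_eq_of_axiom hE .div_div a a a

theorem mul_self_div (hE : axiomsMd ⊆ E) (a : TermAlgebra E) : a * a / a = a := by
  obtain ⟨a, rfl⟩ := mk_surjective a
  exact mk_subst_eq_of_axiom hE .sq_div a a a

theorem div_eq_mul_one_div (hE : axiomsMd ⊆ E) (a b : TermAlgebra E) : a / b = a * (1 / b) := by
  obtain ⟨a, rfl⟩ := mk_surjective a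
  obtain ⟨b, rfl⟩ := mk_surjective b
  exact mk_subst_eq_of_axiom hE .div_eq a b b

/-- Each element of the Lindenbaum algebra is von Neumann regular. -/
theorem mul_self_mul_one_div (hE : axiomsMd ⊆ E) (a : TermAlgebra E) : a * a * (1 / a) = a := by
  rw [← div_eq_mul_one_div hE, mul_self_div hE]

theorem isReduced (hE : axiomsMd ⊆ E) :
    letI := commRing hE
    IsReduced (TermAlgebra E) := by
  let := commRing hE
  refine (isReduced_iff_pow_one_lt 2 one_lt_two).2 fun a ha => ?_
  rw [← mul_self_mul_one_div hE a, ← sq, ha, zero_mul]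

/-- Ring homomorphisms from the Lindenbaum algebra to fields respect division, since division in
the Lindenbaum algebra is determined by equations that involve multiplication only. -/
theorem map_div (hE : axiomsMd ⊆ E) {K : Type*} [Field K] :
    letI := commRing hE
    ∀ (φ : TermAlgebra E →+* K) (a b : TermAlgebra E), φ (a / b) = φ a / φ b := by
  let := commRing hE
  intro φ a b
  rw [div_eq_mul_one_div hE, map_mul, div_eq_mul_inv]
  congr 1
  have h₁ := congrArg φ (mul_self_mul_one_div hE b)
  have h₂ := congrArg φ (mul_self_mul_one_div hE (1 / b))
  rw [one_div_one_div hE] at h₂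
  simp only [map_mul] at h₁ h₂
  rcases eq_or_ne (φ b) 0 with hb | hb
  · rw [← h₂, hb, mul_zero, inv_zero]
  · rw [mul_assoc] at h₁
    exact eq_inv_of_mul_eq_one_right (mul_left_cancel₀ hb (h₁.trans (mul_one _).symm))

/-- Evaluation of a term in a field that receives a homomorphism from the Lindenbaum algebra, under
a valuation that lifts along this homomorphism. -/
theorem eval_eq_map_mk_subst (hE : axiomsMd ⊆ E) {K : Type*} [Field K] :
    letI := commRing hE
    ∀ (φ : TermAlgebra E →+* K) (σ : ℕ → Term) (t : Term),
      t.eval (fun i => φ (mk E (σ i))) = φ (mk E (t.subst σ)) := by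
  let := commRing hE
  intro φ σ t
  induction t with
  | var i => rfl
  | zero => exact (map_zero φ).symm
  | one => exact (map_one φ).symm
  | neg s ih => rw [Term.eval, ih, Term.subst, mk_neg, map_neg]
  | add s t ih₁ ih₂ => rw [Term.eval, ih₁, ih₂, Term.subst, mk_add, map_add]
  | mul s t ih₁ ih₂ => rw [Term.eval, ih₁, ih₂, Term.subst, mk_mul, map_mul]
  | div s t ih₁ ih₂ => rw [Term.eval, ih₁, ih₂, Term.subst, mk_div, map_div hE]

theorem isField_quotient (hE : axiomsMd ⊆ E) :
    letI := commRing hE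
    ∀ (I : Ideal (TermAlgebra E)) [I.IsPrime], IsField (TermAlgebra E ⧸ I) := by
  let := commRing hE
  intro I _
  refine ⟨exists_pair_ne _, mul_comm, fun {a} ha => ?_⟩
  obtain ⟨a, rfl⟩ := Ideal.Quotient.mk_surjective a
  refine ⟨Ideal.Quotient.mk I (1 / a), mul_left_cancel₀ ha ?_⟩
  rw [← mul_assoc, ← map_mul, ← map_mul, mul_self_mul_one_div hE, mul_one]

end TermAlgebra

theorem Term.subst_var (t : Term) : t.subst var = t := by
  induction t <;> simp_all [subst]

/-- Soundness and completeness of equational logic over the axioms of divisive meadows, with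
respect to fields with `a / 0 = 0`. -/
theorem provable_iff {E : Set Equation} (hE : axiomsMd ⊆ E) {s t : Term} :
    Provable E s t ↔
      ∀ (K : Type) [Field K], Satisfies K E → ∀ v : ℕ → K, s.eval v = t.eval v := by
  refine ⟨fun h K _ hK v => h.eval_eq hK v, fun h => ?_⟩
  let := TermAlgebra.commRing hE
  have := TermAlgebra.isReduced hE
  by_contra hst
  have hne : TermAlgebra.mk E s - TermAlgebra.mk E t ∉ nilradical (TermAlgebra E) := by
    rw [nilradical_eq_zero, Ideal.zero_eq_bot, Ideal.mem_bot, sub_eq_zero, TermAlgebra.mk_eq_mk]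
    exact hst
  rw [nilradical_eq_sInf, Ideal.mem_sInf] at hne
  push Not at hne
  obtain ⟨I, hI, hIst⟩ := hne
  have : I.IsPrime := hI
  let : Field (TermAlgebra E ⧸ I) := (TermAlgebra.isField_quotient hE I).toField
  have hsat : Satisfies (TermAlgebra E ⧸ I) E := by
    intro e he v
    have hlift (i : ℕ) : ∃ r : Term, Ideal.Quotient.mk I (TermAlgebra.mk E r) = v i :=
      (Ideal.Quotient.mk_surjective.comp TermAlgebra.mk_surjective) (v i)
    choose σ hσ using hlift
    obtain rfl : (fun i => Ideal.Quotient.mk I (TermAlgebra.mk E (σ i))) = v := funext hσ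
    rw [TermAlgebra.eval_eq_map_mk_subst hE, TermAlgebra.eval_eq_map_mk_subst hE,
      TermAlgebra.mk_eq_mk.2 (Provable.ax e.1 e.2 σ he)]
  refine hIst ?_
  have := h _ hsat fun i => Ideal.Quotient.mk I (TermAlgebra.mk E (.var i))
  rw [TermAlgebra.eval_eq_map_mk_subst hE, TermAlgebra.eval_eq_map_mk_subst hE, Term.subst_var,
    Term.subst_var] at this
  exact Ideal.Quotient.eq.1 this

/-! ### The equations `n / n = 1` -/

theorem eval_numeralDivSelf_iff {K : Type*} [Field K] (v : ℕ → K) (n : ℕ) :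
    (numeralDivSelf n).1.eval v = (numeralDivSelf n).2.eval v ↔ (n : K) ≠ 0 := by
  simp [numeralDivSelf, Term.eval, div_self_eq_one₀]

theorem provable_axiomsMd_iff {s t : Term} :
    Provable axiomsMd s t ↔ ∀ (K : Type) [Field K] (v : ℕ → K), s.eval v = t.eval v :=
  (provable_iff subset_rfl).trans
    ⟨fun h K _ v => h K (satisfies_axiomsMd K) v, fun h K _ _ v => h K v⟩

theorem provable_numeralDivSelf_iff {n : ℕ} {s t : Term} :
    Provable (axiomsMd ∪ {numeralDivSelf n}) s t ↔
      ∀ (K : Type) [Field K], (n : K) ≠ 0 → ∀ v : ℕ → K, s.eval v = t.eval v := by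
  rw [provable_iff Set.subset_union_left]
  refine ⟨fun h K _ hn v => h K ?_ v, fun h K _ hK v => h K ?_ v⟩
  · rintro e (he | rfl) w
    · exact satisfies_axiomsMd K e he w
    · exact (eval_numeralDivSelf_iff w n).2 hn
  · exact (eval_numeralDivSelf_iff v n).1 (hK _ (Or.inr rfl) v)

theorem provable_numeralDivSelf_iff_provable_mul {n : ℕ} {s t : Term} :
    Provable (axiomsMd ∪ {numeralDivSelf n}) s t ↔
      Provable axiomsMd (.mul (.numeral n) s) (.mul (.numeral n) t) := by
  rw [provable_numeralDivSelf_iff, provable_axiomsMd_iff]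
  simp only [Term.eval, Term.eval_numeral, mul_eq_mul_left_iff, or_iff_not_imp_right]
  exact ⟨fun h K _ v hn => h K hn v, fun h K _ hn v => h K v hn⟩

theorem Provable.numeralDivSelf_mul_right {n : ℕ} {s t : Term}
    (h : Provable (axiomsMd ∪ {numeralDivSelf n}) s t) (m : ℕ) :
    Provable (axiomsMd ∪ {numeralDivSelf (n * m)}) s t := by
  rw [provable_numeralDivSelf_iff] at h ⊢
  exact fun K _ hn v => h K (fun h0 => hn (by simp [h0])) v

theorem Provable.numeralDivSelf_mul_left {n : ℕ} {s t : Term}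
    (h : Provable (axiomsMd ∪ {numeralDivSelf n}) s t) (m : ℕ) :
    Provable (axiomsMd ∪ {numeralDivSelf (m * n)}) s t :=
  mul_comm n m ▸ h.numeralDivSelf_mul_right m

/-- A derivation from the axioms and all the equations `n / n = 1` with `n > 0` uses only finitely
many of them, and these follow from the single one for the product. -/
theorem exists_provable_of_provable_numeralDivSelf {s t : Term}
    (h : Provable (axiomsMd ∪ numeralDivSelf '' {n | 0 < n}) s t) :
    ∃ n : ℕ, 0 < n ∧ Provable (axiomsMd ∪ {numeralDivSelf n}) s t := by
  induction h with
  | ax s t σ h =>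
    rcases h with h | ⟨n, hn, h⟩
    · exact ⟨1, one_pos, .ax _ _ _ (Or.inl h)⟩
    · exact ⟨n, hn, .ax _ _ _ (Or.inr h.symm)⟩
  | refl s => exact ⟨1, one_pos, .refl s⟩
  | symm _ _ _ ih =>
    obtain ⟨n, hn, h⟩ := ih
    exact ⟨n, hn, .symm _ _ h⟩
  | trans _ _ _ _ _ ih₁ ih₂ =>
    obtain ⟨n, hn, h⟩ := ih₁
    obtain ⟨m, hm, h'⟩ := ih₂
    exact ⟨n * m, mul_pos hn hm, .trans _ _ _ (h.numeralDivSelf_mul_right m)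
      (h'.numeralDivSelf_mul_left n)⟩
  | neg _ _ _ ih =>
    obtain ⟨n, hn, h⟩ := ih
    exact ⟨n, hn, .neg _ _ h⟩
  | add _ _ _ _ _ _ ih₁ ih₂ =>
    obtain ⟨n, hn, h⟩ := ih₁
    obtain ⟨m, hm, h'⟩ := ih₂
    exact ⟨n * m, mul_pos hn hm, .add _ _ _ _ (h.numeralDivSelf_mul_right m)
      (h'.numeralDivSelf_mul_left n)⟩
  | mul _ _ _ _ _ _ ih₁ ih₂ =>
    obtain ⟨n, hn, h⟩ := ih₁
    obtain ⟨m, hm, h'⟩ := ih₂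
    exact ⟨n * m, mul_pos hn hm, .mul _ _ _ _ (h.numeralDivSelf_mul_right m)
      (h'.numeralDivSelf_mul_left n)⟩
  | div _ _ _ _ _ _ ih₁ ih₂ =>
    obtain ⟨n, hn, h⟩ := ih₁
    obtain ⟨m, hm, h'⟩ := ih₂
    exact ⟨n * m, mul_pos hn hm, .div _ _ _ _ (h.numeralDivSelf_mul_right m)
      (h'.numeralDivSelf_mul_left n)⟩

/-- An equation valid in all fields of characteristic zero is valid in all fields in which a
suitable positive integer is nonzero. -/
theorem exists_provable_of_charZero {s t : Term}
    (h : ∀ (K : Type) [Field K] [CharZero K] (v : ℕ → K), s.eval v = t.eval v) :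
    ∃ n : ℕ, 0 < n ∧ Provable (axiomsMd ∪ {numeralDivSelf n}) s t := by
  refine exists_provable_of_provable_numeralDivSelf ?_
  rw [provable_iff Set.subset_union_left]
  intro K _ hK v
  have : CharZero K := charZero_of_inj_zero fun n hn => by
    by_contra h0
    exact (eval_numeralDivSelf_iff v n).1
      (hK _ (Or.inr ⟨n, Nat.pos_of_ne_zero h0, rfl⟩) v) hn
  exact h K v

/-! ### Unary terms in fields of characteristic zero -/

/-- Away from the zeros of some nonzero polynomial, a unary term is a rational function. -/
theorem exists_eval_eq_aeval_div {x : ℕ} {t : Term} (ht : t.vars ⊆ {x}) :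
    ∃ p q : ℤ[X], q ≠ 0 ∧ ∀ (K : Type) [Field K] (v : ℕ → K),
      aeval (v x) q ≠ 0 → t.eval v = aeval (v x) p / aeval (v x) q := by
  induction t with
  | var i =>
    obtain rfl : i = x := by simpa [Term.vars] using ht
    exact ⟨X, 1, one_ne_zero, fun K _ v _ => by simp [Term.eval]⟩
  | zero => exact ⟨0, 1, one_ne_zero, fun K _ v _ => by simp [Term.eval]⟩
  | one => exact ⟨1, 1, one_ne_zero, fun K _ v _ => by simp [Term.eval]⟩
  | neg s ih =>
    obtain ⟨p, q, hq, h⟩ := ih ht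
    refine ⟨-p, q, hq, fun K _ v hv => ?_⟩
    rw [Term.eval, h K v hv, map_neg, neg_div]
  | add s t ih₁ ih₂ =>
    obtain ⟨hs, ht⟩ := Set.union_subset_iff.1 ht
    obtain ⟨p₁, q₁, hq₁, h₁⟩ := ih₁ hs
    obtain ⟨p₂, q₂, hq₂, h₂⟩ := ih₂ ht
    refine ⟨p₁ * q₂ + q₁ * p₂, q₁ * q₂, mul_ne_zero hq₁ hq₂, fun K _ v hv => ?_⟩
    rw [map_mul, mul_ne_zero_iff] at hv
    rw [Term.eval, h₁ K v hv.1, h₂ K v hv.2, div_add_div _ _ hv.1 hv.2]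
    simp
  | mul s t ih₁ ih₂ =>
    obtain ⟨hs, ht⟩ := Set.union_subset_iff.1 ht
    obtain ⟨p₁, q₁, hq₁, h₁⟩ := ih₁ hs
    obtain ⟨p₂, q₂, hq₂, h₂⟩ := ih₂ ht
    refine ⟨p₁ * p₂, q₁ * q₂, mul_ne_zero hq₁ hq₂, fun K _ v hv => ?_⟩
    rw [map_mul, mul_ne_zero_iff] at hv
    rw [Term.eval, h₁ K v hv.1, h₂ K v hv.2, div_mul_div_comm, map_mul, map_mul]
  | div s t ih₁ ih₂ =>
    obtain ⟨hs, ht⟩ := Set.union_subset_iff.1 ht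
    obtain ⟨p₁, q₁, hq₁, h₁⟩ := ih₁ hs
    obtain ⟨p₂, q₂, hq₂, h₂⟩ := ih₂ ht
    rcases eq_or_ne p₂ 0 with rfl | hp₂
    · refine ⟨0, q₂, hq₂, fun K _ v hv => ?_⟩
      simp [Term.eval, h₂ K v hv]
    -- The fraction is expanded by `q₂`, as the denominator has to vanish where `q₂` does.
    · refine ⟨p₁ * q₂ * q₂, q₁ * p₂ * q₂, by simp [hq₁, hp₂, hq₂], fun K _ v hv => ?_⟩
      simp only [map_mul, mul_ne_zero_iff] at hv
      obtain ⟨⟨hv₁, hv₃⟩, hv₂⟩ := hv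
      rw [Term.eval, h₁ K v hv₁, h₂ K v hv₂]
      simp only [map_mul]
      field_simp

/-- On the zero set of a squarefree polynomial, the inverse of a polynomial function is a
polynomial function. -/
theorem exists_aeval_eq_inv {D : ℚ[X]} (hD : Squarefree D) (h : ℚ[X]) :
    ∃ g : ℚ[X], ∀ (K : Type) [Field K] [CharZero K] (a : K),
      aeval a D = 0 → aeval a g = (aeval a h)⁻¹ := by
  -- `D = e * d`, where `h` vanishes on the zeros of `e` and nowhere on those of `d`
  obtain ⟨e, he⟩ : ∃ e, e = EuclideanDomain.gcd D h := ⟨_, rfl⟩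
  have heh : e ∣ h := he ▸ EuclideanDomain.gcd_dvd_right D h
  obtain ⟨d, rfl⟩ : e ∣ D := he ▸ EuclideanDomain.gcd_dvd_left D h
  have hed : IsCoprime e d := (squarefree_mul_iff.1 hD).1.isCoprime
  have hhd : IsCoprime h d := by
    refine IsRelPrime.isCoprime fun k hkh hkd => ?_
    refine hed.isUnit_of_dvd' (he ▸ ?_) hkd
    exact EuclideanDomain.dvd_gcd (hkd.mul_left e) hkh
  obtain ⟨r, r', hr⟩ := hed
  obtain ⟨u, u', hu⟩ := hhd
  refine ⟨r * e * u, fun K _ _ a ha => ?_⟩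
  obtain ⟨k, rfl⟩ := heh
  rw [map_mul, mul_eq_zero] at ha
  rcases ha with ha | ha
  · simp [ha]
  · have hr' := congrArg (aeval a) hr
    have hu' := congrArg (aeval a) hu
    simp only [map_add, map_mul, ha, map_one, mul_zero, add_zero] at hr' hu'
    refine eq_inv_of_mul_eq_one_left ?_
    simp only [map_mul]
    rw [hr', one_mul, hu']

/-- On the zero set of a squarefree polynomial, a unary term is a polynomial function. -/
theorem exists_eval_eq_aeval_of_squarefree {x : ℕ} {t : Term} (ht : t.vars ⊆ {x}) {D : ℚ[X]}
    (hD : Squarefree D) :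
    ∃ g : ℚ[X], ∀ (K : Type) [Field K] [CharZero K] (v : ℕ → K),
      aeval (v x) D = 0 → t.eval v = aeval (v x) g := by
  induction t with
  | var i =>
    obtain rfl : i = x := by simpa [Term.vars] using ht
    exact ⟨X, fun K _ _ v _ => by simp [Term.eval]⟩
  | zero => exact ⟨0, fun K _ _ v _ => by simp [Term.eval]⟩
  | one => exact ⟨1, fun K _ _ v _ => by simp [Term.eval]⟩
  | neg s ih =>
    obtain ⟨g, h⟩ := ih ht
    exact ⟨-g, fun K _ _ v hv => by rw [Term.eval, h K v hv, map_neg]⟩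
  | add s t ih₁ ih₂ =>
    obtain ⟨hs, ht⟩ := Set.union_subset_iff.1 ht
    obtain ⟨g₁, h₁⟩ := ih₁ hs
    obtain ⟨g₂, h₂⟩ := ih₂ ht
    exact ⟨g₁ + g₂, fun K _ _ v hv => by rw [Term.eval, h₁ K v hv, h₂ K v hv, map_add]⟩
  | mul s t ih₁ ih₂ =>
    obtain ⟨hs, ht⟩ := Set.union_subset_iff.1 ht
    obtain ⟨g₁, h₁⟩ := ih₁ hs
    obtain ⟨g₂, h₂⟩ := ih₂ ht
    exact ⟨g₁ * g₂, fun K _ _ v hv => by rw [Term.eval, h₁ K v hv, h₂ K v hv, map_mul]⟩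
  | div s t ih₁ ih₂ =>
    obtain ⟨hs, ht⟩ := Set.union_subset_iff.1 ht
    obtain ⟨g₁, h₁⟩ := ih₁ hs
    obtain ⟨g₂, h₂⟩ := ih₂ ht
    obtain ⟨g₃, h₃⟩ := exists_aeval_eq_inv hD g₂
    refine ⟨g₁ * g₃, fun K _ _ v hv => ?_⟩
    rw [Term.eval, h₁ K v hv, h₂ K v hv, map_mul, h₃ K _ hv, div_eq_mul_inv]

/-- On the zero set of a nonzero polynomial, a unary term is a polynomial function. -/
theorem exists_eval_eq_aeval {x : ℕ} {t : Term} (ht : t.vars ⊆ {x}) {q : ℤ[X]} (hq : q ≠ 0) :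
    ∃ g : ℚ[X], ∀ (K : Type) [Field K] [CharZero K] (v : ℕ → K),
      aeval (v x) q = 0 → t.eval v = aeval (v x) g := by
  have hq' : q.map (Int.castRingHom ℚ) ≠ 0 :=
    (Polynomial.map_ne_zero_iff Int.cast_injective).2 hq
  obtain ⟨g, h⟩ := exists_eval_eq_aeval_of_squarefree ht
    (UniqueFactorizationMonoid.squarefree_radical (a := q.map (Int.castRingHom ℚ)))
  refine ⟨g, fun K _ _ v hv => h K v ?_⟩
  obtain ⟨k, hk⟩ : ∃ k, q.map (Int.castRingHom ℚ) ∣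
      UniqueFactorizationMonoid.radical (q.map (Int.castRingHom ℚ)) ^ k :=
    UniqueFactorizationMonoid.exists_dvd_radical_self_pow hq'
  have hmap : aeval (v x) (q.map (Int.castRingHom ℚ)) = aeval (v x) q :=
    aeval_map_algebraMap ℚ (v x) q
  have := map_dvd (aeval (v x)) hk
  rw [hmap, hv, zero_dvd_iff, map_pow] at this
  exact eq_zero_of_pow_eq_zero this

/-! ### Polynomials as terms -/

/-- Integer polynomials are represented by terms without division. -/
theorem exists_divFree_eval_eq (x : ℕ) (p : ℤ[X]) :
    ∃ s : Term, s.DivFree ∧ s.vars ⊆ {x} ∧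
      ∀ (K : Type) [Field K] (v : ℕ → K), s.eval v = aeval (v x) p := by
  induction p using Polynomial.induction_on with
  | C a =>
    obtain ⟨n, rfl | rfl⟩ := a.eq_nat_or_neg
    · exact ⟨.numeral n, Term.divFree_numeral n, by simp, fun K _ v => by simp⟩
    · exact ⟨.neg (.numeral n), Term.divFree_numeral n, by simp [Term.vars],
        fun K _ v => by simp [Term.eval]⟩
  | add p q hp hq =>
    obtain ⟨s, hs, hs', h₁⟩ := hp
    obtain ⟨t, ht, ht', h₂⟩ := hq
    exact ⟨.add s t, ⟨hs, ht⟩, Set.union_subset hs' ht', fun K _ v => by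
      rw [Term.eval, h₁, h₂, map_add]⟩
  | monomial n a ih =>
    obtain ⟨s, hs, hs', h⟩ := ih
    refine ⟨.mul s (.var x), ⟨hs, trivial⟩, Set.union_subset hs' subset_rfl, fun K _ v => ?_⟩
    rw [Term.eval, h, Term.eval, pow_succ, ← mul_assoc, map_mul _ _ X, aeval_X]

/-- Rational polynomials are represented by polynomials in the syntactic sense. -/
theorem exists_isPolynomial_eval_eq (x : ℕ) (g : ℚ[X]) :
    ∃ s : Term, s.IsPolynomial ∧ s.vars ⊆ {x} ∧
      ∀ (K : Type) [Field K] [CharZero K] (v : ℕ → K), s.eval v = aeval (v x) g := by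
  induction g using Polynomial.induction_on with
  | C a =>
    obtain ⟨c, hc, hc', h⟩ : ∃ c : Term, c.DivFree ∧ c.vars = ∅ ∧
        ∀ (K : Type) [Field K] (v : ℕ → K), c.eval v = (a.num : K) := by
      obtain ⟨n, hn | hn⟩ := a.num.eq_nat_or_neg
      · exact ⟨.numeral n, Term.divFree_numeral n, by simp, fun K _ v => by simp [hn]⟩
      · exact ⟨.neg (.numeral n), Term.divFree_numeral n, by simp [Term.vars],
          fun K _ v => by simp [Term.eval, hn]⟩
    have hvars : (Term.div c (.numeral a.den)).vars = ∅ := by simp [Term.vars, hc']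
    refine ⟨.div c (.numeral a.den),
      .const _ ⟨c, _, hc, Term.divFree_numeral a.den, rfl⟩ hvars, by simp [hvars],
      fun K _ _ v => ?_⟩
    rw [Term.eval, h, Term.eval_numeral, aeval_C, eq_ratCast, Rat.cast_def]
  | add p q hp hq =>
    obtain ⟨s, hs, hs', h₁⟩ := hp
    obtain ⟨t, ht, ht', h₂⟩ := hq
    exact ⟨.add s t, .add _ _ hs ht, Set.union_subset hs' ht', fun K _ _ v => by
      rw [Term.eval, h₁, h₂, map_add]⟩
  | monomial n a ih =>
    obtain ⟨s, hs, hs', h⟩ := ih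
    refine ⟨.mul s (.var x), .mul _ _ hs (.var x), Set.union_subset hs' subset_rfl,
      fun K _ _ v => ?_⟩
    rw [Term.eval, h, Term.eval, pow_succ, ← mul_assoc, map_mul _ _ X, aeval_X]

/-- Rational polynomials have a common denominator of their coefficients. -/
theorem exists_smul_eq_map_int (g : ℚ[X]) :
    ∃ (m : ℤ) (G : ℤ[X]), m ≠ 0 ∧ ∀ (K : Type) [Field K] [CharZero K] (a : K),
      aeval a G = m * aeval a g := by
  obtain ⟨m, hm0, hm⟩ := IsLocalization.integerNormalization_spec (nonZeroDivisors ℤ) g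
  refine ⟨m, IsLocalization.integerNormalization (nonZeroDivisors ℤ) g,
    nonZeroDivisors.ne_zero hm0, fun K _ _ a => ?_⟩
  rw [← aeval_map_algebraMap ℚ a, hm]
  simp

/-- In characteristic zero, a unary term is the sum of a polynomial and a simple fraction. -/
theorem exists_eval_eq_polynomial_add_fraction {x : ℕ} {t : Term} (ht : t.vars ⊆ {x}) :
    ∃ g f : Term, g.IsPolynomial ∧ g.vars ⊆ {x} ∧ f.IsSimpleFraction ∧ f.vars ⊆ {x} ∧
      ∀ (K : Type) [Field K] [CharZero K] (v : ℕ → K), t.eval v = (Term.add g f).eval v := by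
  obtain ⟨p, q, hq, hpq⟩ := exists_eval_eq_aeval_div ht
  obtain ⟨G, hG⟩ := exists_eval_eq_aeval ht hq
  obtain ⟨m, G', hm, hG'⟩ := exists_smul_eq_map_int G
  obtain ⟨g, hg, hgx, hgG⟩ := exists_isPolynomial_eval_eq x G
  -- the fraction `(p - G q) / q`, with the denominators of `G` cleared
  obtain ⟨r, hr, hrx, hrp⟩ := exists_divFree_eval_eq x (C m * p - G' * q)
  obtain ⟨s, hs, hsx, hsq⟩ := exists_divFree_eval_eq x (C m * q)
  refine ⟨g, .div r s, hg, hgx, ⟨r, s, hr, hs, rfl⟩, Set.union_subset hrx hsx, fun K _ _ v => ?_⟩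
  have hmK : (m : K) ≠ 0 := Int.cast_ne_zero.2 hm
  simp only [Term.eval, hgG, hrp, hsq, map_sub, map_mul, eq_intCast, map_intCast, hG']
  rcases eq_or_ne (aeval (v x) q) 0 with h0 | h0
  · simp [h0, hG K v h0]
  · rw [hpq K v h0]
    field_simp
    ring

end DivisiveMeadow

/-- For every term `t` in at most one variable `x` there are a polynomial `g` and a simple fraction
`f` in (at most) the same variable and a natural number `n > 0` such that `t = g + f` is provable
from the axioms of divisive meadows together with `n / n = 1`, and `n ⬝ t = n ⬝ (g + f)` is provable
from the axioms of divisive meadows alone; moreover, for all such `g`, `f` and `n` these two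
provability claims are equivalent. -/
theorem mainTheorem3 (x : ℕ) (t : DivisiveMeadow.Term) (ht : t.vars ⊆ {x}) :
    (∃ (g f : DivisiveMeadow.Term) (n : ℕ),
      g.IsPolynomial ∧ g.vars ⊆ {x} ∧ f.IsSimpleFraction ∧ f.vars ⊆ {x} ∧ 0 < n ∧
      DivisiveMeadow.Provable
        (DivisiveMeadow.axiomsMd ∪ {DivisiveMeadow.numeralDivSelf n}) t (.add g f) ∧
      DivisiveMeadow.Provable DivisiveMeadow.axiomsMd
        (.mul (.numeral n) t) (.mul (.numeral n) (.add g f))) ∧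
    (∀ (g f : DivisiveMeadow.Term) (n : ℕ),
      g.IsPolynomial → g.vars ⊆ {x} → f.IsSimpleFraction → f.vars ⊆ {x} → 0 < n →
      (DivisiveMeadow.Provable
        (DivisiveMeadow.axiomsMd ∪ {DivisiveMeadow.numeralDivSelf n}) t (.add g f) ↔
      DivisiveMeadow.Provable DivisiveMeadow.axiomsMd
        (.mul (.numeral n) t) (.mul (.numeral n) (.add g f)))) := by
  refine ⟨?_, fun g f n _ _ _ _ _ => DivisiveMeadow.provable_numeralDivSelf_iff_provable_mul⟩
  obtain ⟨g, f, hg, hgx, hf, hfx, h⟩ :=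
    DivisiveMeadow.exists_eval_eq_polynomial_add_fraction ht
  obtain ⟨n, hn, hp⟩ := DivisiveMeadow.exists_provable_of_charZero h
  exact ⟨g, f, n, hg, hgx, hf, hfx, hn, hp,
    DivisiveMeadow.provable_numeralDivSelf_iff_provable_mul.1 hp⟩
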